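/- Let $W$ be a Coxeter group with finite set $S$ of simple reflections, so that $W$ is generated by $S$ with relations $(st)^{m_{st}}=1$ for $s,t\in S$ with $m_{st}<\infty$, where $m_{ss}=1$ and $m_{st}=m_{ts}\in\{2,3,\dots\}\cup\{\infty\}$ for $s\ne t$; let $\ell$ be the length function. For $w\in W$ let $D_R(w)=\{s\in S:\ell(ws)<\ell(w)\}$ be the right descent set. A subset $T\subseteq S$ is called independent if its elements commute pairwise in $W$; then $wT$ denotes $w\prod_{s\in T}s$. Let $V=\mathbb{R}^S$ with standard basis $(r_s)_{s\in S}$, the symmetric bilinear form given by $(r_s,r_t)=-\cos(\pi/m_{st})$ (and $-1$ if $m_{st}=\infty$), and the action of $W$ given by $s\,v=v-2(r_s,v)r_s$. The roots are the vectors $w r_s$ with $w\in W$, $s\in S$; a root is positive (negative) if all its coordinates are $\ge 0$ ($\le 0$). Let $R(w)$ be the set of positive roots $r$ such that $w^{-1}r$ is negative. For $s\notin D_R(w)$ and $\lambda:R(w)\to\mathbb{N}_+$ define $\Phi(\lambda,s):R(ws)\to\mathbb{N}_+$ by $\Phi(\lambda,s)(r)=\lambda(r)$ if $r\in R(w)$,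 and otherwise $$\Phi(\lambda,s)(r)=1+\max\{\lambda(r') : r'\in R(w),\ (r,r')>0\},$$ where the maximum of the empty set is $0$. Let $C(e)$ consist of the empty function, and for $w\neq e$ let $C(w)$ be the set of all functions $\Phi(\lambda,s)$ with $s\in D_R(w)$ and $\lambda\in C(ws)$. Two words in $S$ are in the same commutation class if one can be transformed into the other by repeatedly interchanging adjacent letters that commute in $W$. Theorem. For every $w\in W$ the set $C(w)$ is finite, the set of commutation classes of reduced words of $w$ is finite, and the two sets have the same number of elements. If $w\ne e$, then $$|C(w)|=\sum_{\substack{\emptyset\ne T\subseteq D_R(w)\\ T\text{ independent}}}(-1)^{|T|+1}\,|C(wT)| .$$ -/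

import Mathlib

namespace CoxeterSystem

section Geometric

variable {B : Type*} [Fintype B] [DecidableEq B]

/-- The real vector space `ℝ^S` with coordinates indexed by the simple reflections. -/
abbrev RootSpace (B : Type*) := B → ℝ

/-- The simple root `r_s`: the standard basis vector at `s`. -/
def simpleRoot (s : B) : RootSpace B := Pi.single s 1

/-- The symmetric bilinear form with `(r_s, r_t) = -cos (π / m_{st})`, and `-1` when
`m_{st} = ∞` (which Mathlib encodes as `M s t = 0`). -/
noncomputable def rootForm (M : CoxeterMatrix B) : LinearMap.BilinForm ℝ (RootSpace B) :=
  Matrix.toBilin' (Matrix.of fun s t : B =>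
    if M s t = 0 then (-1 : ℝ) else -Real.cos (Real.pi / (M s t : ℝ)))

theorem rootForm_simpleRoot (M : CoxeterMatrix B) (s t : B) :
    rootForm M (simpleRoot s) (simpleRoot t) =
      if M s t = 0 then (-1 : ℝ) else -Real.cos (Real.pi / (M s t : ℝ)) := by
  simp [rootForm, simpleRoot, Matrix.toBilin'_single]

theorem two_smul_rootForm_self (M : CoxeterMatrix B) (s : B) :
    ((2 : ℝ) • rootForm M (simpleRoot s)) (simpleRoot s) = 2 := by
  rw [LinearMap.smul_apply, rootForm_simpleRoot]
  simp

/-- The reflection `v ↦ v - 2 (r_s, v) r_s`. -/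
noncomputable def simpleReflection (M : CoxeterMatrix B) (s : B) :
    RootSpace B ≃ₗ[ℝ] RootSpace B :=
  Module.reflection (two_smul_rootForm_self M s)

theorem simpleReflection_apply (M : CoxeterMatrix B) (s : B) (v : RootSpace B) :
    simpleReflection M s v = v - (2 * rootForm M (simpleRoot s) v) • simpleRoot s := by
  simp [simpleReflection, Module.reflection_apply]

theorem simpleReflection_isLiftable (M : CoxeterMatrix B) :
    M.IsLiftable (simpleReflection M) := by
  intro i j
  rcases eq_or_ne i j with rfl | hij
  · rw [M.diagonal, pow_one]
    ext1 v
    exact Module.involutive_reflection (two_smul_rootForm_self M i) v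
  by_cases h0 : M i j = 0
  · rw [h0, pow_zero]
  set m : ℕ := M i j with hm
  have hm1 : m ≠ 1 := M.off_diagonal i j hij
  set c : ℝ := Real.cos (Real.pi / (m : ℝ)) with hc
  have hfy : ((2 : ℝ) • rootForm M (simpleRoot i)) (simpleRoot j) = -(2 * c) := by
    rw [LinearMap.smul_apply, rootForm_simpleRoot, if_neg h0]
    simp [hc, hm]
  have hgx : ((2 : ℝ) • rootForm M (simpleRoot j)) (simpleRoot i) = -(2 * c) := by
    rw [LinearMap.smul_apply, rootForm_simpleRoot, M.symmetric j i, if_neg h0]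
    simp [hc, hm]
  ext1 v
  unfold simpleReflection
  set φ : ℝ := 2 * (Real.pi / (m : ℝ)) with hφ
  have ht : 2 * Real.cos φ = ((2 : ℝ) • rootForm M (simpleRoot i)) (simpleRoot j) *
      ((2 : ℝ) • rootForm M (simpleRoot j)) (simpleRoot i) - 2 := by
    rw [hfy, hgx, hφ, Real.cos_two_mul, ← hc]; ring
  have key := Module.reflection_mul_reflection_pow_apply (two_smul_rootForm_self M i)
    (two_smul_rootForm_self M j) m v (2 * Real.cos φ) ht
  rw [key, hfy, hgx]
  have hS := Polynomial.Chebyshev.S_two_mul_real_cos φ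
  have hmR : (m : ℝ) ≠ 0 := by exact_mod_cast h0
  rcases eq_or_ne m 2 with h2 | h2
  · have hc0 : c = 0 := by rw [hc, h2]; simp
    have hcφ : Real.cos φ = -1 := by
      rw [hφ, h2]; simp [mul_div_cancel₀]
    rw [h2, hcφ, hc0]
    norm_num [Polynomial.Chebyshev.S_one, Polynomial.Chebyshev.S_zero]
    abel
  have hsin : Real.sin φ ≠ 0 := by
    have hm3 : (3 : ℝ) ≤ m := by
      have : 3 ≤ m := by omega
      exact_mod_cast this
    apply ne_of_gt
    apply Real.sin_pos_of_pos_of_lt_pi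
    · have := Real.pi_pos
      positivity
    · rw [hφ, ← mul_div_assoc, div_lt_iff₀ (by linarith)]
      nlinarith [Real.pi_pos]
  have hmφ : (m : ℝ) * φ = 2 * Real.pi := by rw [hφ]; field_simp
  rcases Nat.even_or_odd' m with ⟨k, hk | hk⟩
  · have e1 : ((m : ℤ) - 2) / 2 = (k : ℤ) - 1 := by omega
    have e2 : ((m : ℤ) - 1) / 2 = (k : ℤ) - 1 := by omega
    have hz : (Polynomial.Chebyshev.S ℝ ((k : ℤ) - 1)).eval (2 * Real.cos φ) = 0 := by
      have := hS ((k : ℤ) - 1)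
      have hkφ : (k : ℝ) * φ = Real.pi := by
        rw [hk] at hmφ; push_cast at hmφ; linarith
      push_cast at this
      rw [sub_add_cancel, hkφ, Real.sin_pi] at this
      exact (mul_eq_zero.mp this).resolve_right hsin
    rw [e1, e2, hz]
    simp
  · have e1 : ((m : ℤ) - 2) / 2 = (k : ℤ) - 1 := by omega
    have e2 : ((m : ℤ) - 1) / 2 = (k : ℤ) := by omega
    have e3 : ((m : ℤ) - 3) / 2 = (k : ℤ) - 1 := by omega
    have e4 : (m : ℤ) / 2 = (k : ℤ) := by omega
    have hz : (Polynomial.Chebyshev.S ℝ (k : ℤ)).eval (2 * Real.cos φ) +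
        (Polynomial.Chebyshev.S ℝ ((k : ℤ) - 1)).eval (2 * Real.cos φ) = 0 := by
      have h1 := hS ((k : ℤ) - 1)
      have h2 := hS (k : ℤ)
      push_cast at h1 h2
      rw [sub_add_cancel] at h1
      have hkφ : ((k : ℝ) + 1) * φ = 2 * Real.pi - k * φ := by
        rw [hk] at hmφ; push_cast at hmφ; linarith
      rw [hkφ, Real.sin_two_pi_sub] at h2
      have : ((Polynomial.Chebyshev.S ℝ (k : ℤ)).eval (2 * Real.cos φ) +
        (Polynomial.Chebyshev.S ℝ ((k : ℤ) - 1)).eval (2 * Real.cos φ)) * Real.sin φ = 0 := by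
        rw [add_mul, h1, h2]; ring
      exact (mul_eq_zero.mp this).resolve_right hsin
    rw [e1, e2, e3, e4, hz]
    simp

end Geometric

section Roots

variable {B W : Type*} [Fintype B] [DecidableEq B] [Group W] {M : CoxeterMatrix B}
  (cs : CoxeterSystem M W)

/-- The geometric representation of `W` on `ℝ^S`, with `s v = v - 2 (r_s, v) r_s`. -/
noncomputable def geomRep : W →* (RootSpace B ≃ₗ[ℝ] RootSpace B) :=
  cs.lift ⟨simpleReflection M, simpleReflection_isLiftable M⟩

theorem geomRep_simple (s : B) : cs.geomRep (cs.simple s) = simpleReflection M s :=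
  cs.lift_apply_simple (simpleReflection_isLiftable M) s

/-- The root system: all vectors `w r_s`. -/
def rootSet : Set (RootSpace B) := {r | ∃ (w : W) (s : B), r = cs.geomRep w (simpleRoot s)}

/-- Roots with nonnegative coefficients. -/
def positiveRoots : Set (RootSpace B) := {r | r ∈ cs.rootSet ∧ ∀ s, 0 ≤ r s}

/-- Roots with nonpositive coefficients. -/
def negativeRoots : Set (RootSpace B) := {r | r ∈ cs.rootSet ∧ ∀ s, r s ≤ 0}

/-- `R(w)`: the inversions of `w⁻¹`, i.e. the positive roots sent to negative roots by `w⁻¹`. -/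
def invSet (w : W) : Set (RootSpace B) :=
  {r | r ∈ cs.positiveRoots ∧ cs.geomRep w⁻¹ r ∈ cs.negativeRoots}

open Classical in
/-- `Φ(λ, s) : R(ws) → ℕ₊` for `λ : R(w) → ℕ₊` (used when `s` is not a right descent of `w`).
It extends `λ` by giving a new root `r` the value `1 + max {λ(r') | r' ∈ R(w), (r, r') > 0}`;
the supremum of the empty set of natural numbers is `0`, so the value is `1` if there is no
such `r'`. -/
noncomputable def extendDepth (w : W) (s : B) (lam : cs.invSet w → ℕ+) :
    cs.invSet (w * cs.simple s) → ℕ+ :=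
  fun r =>
    if h : (r : RootSpace B) ∈ cs.invSet w then lam ⟨r, h⟩
    else Nat.succPNat
      (sSup {n : ℕ | ∃ r' : cs.invSet w, 0 < rootForm M (r : RootSpace B) r' ∧ n = lam r'})

/-- Membership in `C(w)`: start from the empty function on `R(1) = ∅`, and apply `Φ(·, s)`
along `w ↦ ws` with `ℓ(ws) > ℓ(w)` (equivalently, `s` is a right descent of `ws`). -/
inductive IsDepthFunction : (w : W) → (cs.invSet w → ℕ+) → Prop
  | one (lam : cs.invSet 1 → ℕ+) : IsDepthFunction 1 lam
  | step (w : W) (s : B) (hs : ¬ cs.IsRightDescent w s) (lam : cs.invSet w → ℕ+)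
      (hlam : IsDepthFunction w lam) :
      IsDepthFunction (w * cs.simple s) (cs.extendDepth w s lam)

/-- The set `C(w)` of functions `R(w) → ℕ₊`. -/
def depthFunctions (w : W) : Set (cs.invSet w → ℕ+) := {lam | cs.IsDepthFunction w lam}

end Roots

section Words

variable {B W : Type*} [Group W] {M : CoxeterMatrix B} (cs : CoxeterSystem M W)

/-- One application of a commutation relation: two adjacent letters that commute in `W`
are interchanged. -/
def CommutationStep (u v : List B) : Prop :=
  ∃ (x y : List B) (a b : B), Commute (cs.simple a) (cs.simple b) ∧
    u = x ++ a :: b :: y ∧ v = x ++ b :: a :: y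

/-- The reduced words of `w`. -/
def ReducedWord (w : W) : Type _ := {u : List B // cs.IsReduced u ∧ cs.wordProd u = w}

/-- Two reduced words are in the same commutation class if commutation relations alone
transform one into the other. -/
def commutationSetoid (w : W) : Setoid (cs.ReducedWord w) :=
  (Relation.EqvGen.setoid cs.CommutationStep).comap Subtype.val

/-- The commutation classes of reduced words of `w`. -/
def CommutationClass (w : W) : Type _ := Quotient (cs.commutationSetoid w)

/-- A set of simple reflections is independent if its elements commute with each other. -/
def IsIndependent (T : Finset B) : Prop :=
  (T : Set B).Pairwise (Function.onFun Commute cs.simple)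

/-- The product in `W` of the elements of an independent set. -/
noncomputable def independentProd (T : Finset B) (hT : cs.IsIndependent T) : W :=
  T.noncommProd cs.simple hT

/-- The nonempty independent subsets of the right descent set `D_R(w)`. -/
def IndependentDescents (w : W) : Type _ :=
  {T : Finset B // T.Nonempty ∧ (∀ s ∈ T, cs.IsRightDescent w s) ∧ cs.IsIndependent T}

open Classical in
noncomputable instance [Fintype B] (w : W) : Fintype (cs.IndependentDescents w) :=
  inferInstanceAs (Fintype {T : Finset B //
    T.Nonempty ∧ (∀ s ∈ T, cs.IsRightDescent w s) ∧ cs.IsIndependent T})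

end Words

end CoxeterSystem

namespace CoxeterSystem

/-! ### The bilinear form and the coefficients of dihedral roots. -/

section Form

variable {B : Type*} [Fintype B] [DecidableEq B]

/-! A reduced word builds its inversion set one root at a time: appending `s` to a word of `w` adds
the root `w r_s`. This rests on every root being positive or negative (`geomRep_simpleRoot_nonneg`).
Words are stored last letter first, so `v` represents `(cs.wordProd v)⁻¹`, and `wordDepth` is its
depth function extended by zero.

Swapping commuting letters `a`, `b` leaves the depth function alone: the roots `w r_a` and `w r_b`
are orthogonal, so neither enters the maximum of the other. Conversely, depth determines the class.
If a word ends in `s`, its last root has greater depth than every inversion at an acute angle to it.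
In another reduced word with the same depth, the letter giving this root must commute past all later
letters: the first later letter not commuting with it would give an acute root of larger depth
(`forall_commute_or_exists_lt`). So `s` moves to the end, and induction on the word finishes
(`commutationEquiv_of_wordDepth_eq`).

For the formula, cover the depth functions of `w ≠ 1` by the sets `depthSetEnding w s` and apply
inclusion-exclusion. An intersection over `T` is empty unless `T` consists of commuting descents;
otherwise stripping the letters of `T` identifies it with the depth functions of `wT`
(`ncard_depthSetEndings`). -/

theorem rootForm_comm (M : CoxeterMatrix B) (x y : RootSpace B) :
    rootForm M x y = rootForm M y x := by
  simp only [rootForm, Matrix.toBilin'_apply, Matrix.of_apply]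
  rw [Finset.sum_comm]
  refine Finset.sum_congr rfl fun i _ => Finset.sum_congr rfl fun j _ => ?_
  rw [M.symmetric i j]
  ring

theorem rootForm_simpleRoot_self (M : CoxeterMatrix B) (s : B) :
    rootForm M (simpleRoot s) (simpleRoot s) = 1 := by
  simp [rootForm_simpleRoot]

theorem simpleReflection_simpleRoot_self (M : CoxeterMatrix B) (s : B) :
    simpleReflection M s (simpleRoot s) = -simpleRoot s := by
  rw [simpleReflection_apply, rootForm_simpleRoot_self, mul_one, two_smul]
  abel

theorem rootForm_simpleReflection (M : CoxeterMatrix B) (s : B) (x y : RootSpace B) :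
    rootForm M (simpleReflection M s x) (simpleReflection M s y) = rootForm M x y := by
  simp only [simpleReflection_apply, map_sub, map_smul, LinearMap.sub_apply, LinearMap.smul_apply,
    smul_eq_mul, rootForm_simpleRoot_self, rootForm_comm M x (simpleRoot s)]
  ring

theorem rootForm_simpleRoot_nonpos (M : CoxeterMatrix B) {s t : B} (h : s ≠ t) :
    rootForm M (simpleRoot s) (simpleRoot t) ≤ 0 := by
  rw [rootForm_simpleRoot]
  split_ifs with h0
  · norm_num
  · have h1 := M.off_diagonal s t h
    have h2 : (2 : ℝ) ≤ M s t := by exact_mod_cast (by omega : 2 ≤ M s t)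
    rw [neg_nonpos]
    apply Real.cos_nonneg_of_neg_pi_div_two_le_of_le
    · have := Real.pi_pos
      have : 0 ≤ Real.pi / (M s t : ℝ) := by positivity
      linarith
    · gcongr

/-- The coefficients of the roots of a dihedral subgroup, a rescaled Chebyshev sequence. -/
theorem exists_dihedral_coefficients (M : CoxeterMatrix B) {s t : B} (h : s ≠ t) :
    ∃ U : ℕ → ℝ, U 0 = 0 ∧ U 1 = 1 ∧
      (∀ k, U (k + 2) = -(2 * rootForm M (simpleRoot s) (simpleRoot t)) * U (k + 1) - U k) ∧
      ∀ k, M s t = 0 ∨ k ≤ M s t → 0 ≤ U k := by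
  rw [rootForm_simpleRoot]
  by_cases h0 : M s t = 0
  -- Here the form takes the value -1, and the recurrence `U (k+2) = 2 U (k+1) - U k` has the linear
  -- solution.
  · refine ⟨fun k => k, by simp, by simp, fun k => ?_, fun k _ => Nat.cast_nonneg k⟩
    rw [if_pos h0]
    push_cast
    ring
  · have h1 := M.off_diagonal s t h
    have h2 : (2 : ℝ) ≤ M s t := by exact_mod_cast (by omega : 2 ≤ M s t)
    rw [if_neg h0]
    set θ : ℝ := Real.pi / (M s t : ℝ) with hθ
    have hpi := Real.pi_pos
    have hMθ : (M s t : ℝ) * θ = Real.pi := by rw [hθ]; field_simp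
    have hθ0 : 0 < θ := by positivity
    have hsin : 0 < Real.sin θ := Real.sin_pos_of_pos_of_lt_pi hθ0 (by nlinarith)
    -- With form value `-cos θ`, the recurrence is the addition formula for sine; nonnegativity
    -- lasts while `kθ ≤ π`.
    refine ⟨fun k => Real.sin (k * θ) / Real.sin θ, by simp, by simp [hsin.ne'], fun k => ?_, ?_⟩
    · have e2 : ((k + 2 : ℕ) : ℝ) * θ = (k + 1 : ℕ) * θ + θ := by push_cast; ring
      have e0 : (k : ℝ) * θ = (k + 1 : ℕ) * θ - θ := by push_cast; ring
      beta_reduce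
      rw [e2, e0, Real.sin_add, Real.sin_sub]
      field_simp
      ring
    · rintro k (hk | hk)
      · exact absurd hk h0
      · refine div_nonneg (Real.sin_nonneg_of_nonneg_of_le_pi (by positivity) ?_) hsin.le
        rw [← hMθ]
        gcongr

end Form

theorem simpleRoot_nonneg {B : Type*} [DecidableEq B] (s : B) : 0 ≤ (simpleRoot s : RootSpace B) := by
  intro t
  by_cases h : t = s <;> simp [simpleRoot, h]

/-! ### Factorisation along a dihedral subgroup. -/

section Words

variable {B W : Type*} [Group W] {M : CoxeterMatrix B} (cs : CoxeterSystem M W)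

/-- Every element factors, with lengths adding up, as one without descents `a`, `b` times an
alternating word ending in `b`. -/
theorem exists_eq_mul_alternatingWord (n : ℕ) : ∀ (w : W) (a b : B), cs.length w = n →
    ¬cs.IsRightDescent w a → ∃ (k : ℕ) (v : W), w = v * cs.wordProd (alternatingWord a b k) ∧
      cs.length w = cs.length v + k ∧ ¬cs.IsRightDescent v a ∧ ¬cs.IsRightDescent v b := by
  induction n with
  | zero =>
    intro w a b hn ha
    refine ⟨0, w, by simp [alternatingWord], rfl, ha, fun hb => ?_⟩
    have := cs.isRightDescent_iff.1 hb
    omega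
  | succ n ih =>
    intro w a b hn ha
    by_cases hb : cs.IsRightDescent w b
    · have hl := cs.isRightDescent_iff.1 hb
      obtain ⟨k, v, hv, hlen, h1, h2⟩ := ih (w * cs.simple b) b a (by omega)
        (cs.isRightDescent_iff_not_isRightDescent_mul.1 hb)
      refine ⟨k + 1, v, ?_, by omega, h2, h1⟩
      rw [alternatingWord_succ, wordProd_concat, ← mul_assoc, ← hv,
        simple_mul_simple_cancel_right]
    · exact ⟨0, w, by simp [alternatingWord], rfl, ha, hb⟩

end Words

/-! ### Roots, their signs, and inversion sets. -/

section Roots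

variable {B W : Type*} [Fintype B] [DecidableEq B] [Group W] {M : CoxeterMatrix B}
  (cs : CoxeterSystem M W)

theorem geomRep_mul_apply (v w : W) (x : RootSpace B) :
    cs.geomRep (v * w) x = cs.geomRep v (cs.geomRep w x) := by
  rw [map_mul, LinearEquiv.mul_apply]

theorem geomRep_inv_apply_self (w : W) (x : RootSpace B) :
    cs.geomRep w⁻¹ (cs.geomRep w x) = x := by
  rw [← geomRep_mul_apply, inv_mul_cancel, map_one]
  rfl

theorem geomRep_apply_inv_self (w : W) (x : RootSpace B) :
    cs.geomRep w (cs.geomRep w⁻¹ x) = x := by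
  rw [← geomRep_mul_apply, mul_inv_cancel, map_one]
  rfl

theorem geomRep_simple_apply (s : B) (x : RootSpace B) :
    cs.geomRep (cs.simple s) x = x - (2 * rootForm M (simpleRoot s) x) • simpleRoot s := by
  rw [geomRep_simple, simpleReflection_apply]

theorem geomRep_simple_simpleRoot (s : B) :
    cs.geomRep (cs.simple s) (simpleRoot s) = -simpleRoot s := by
  rw [geomRep_simple, simpleReflection_simpleRoot_self]

theorem geomRep_mul_simple_simpleRoot (w : W) (s : B) :
    cs.geomRep (w * cs.simple s) (simpleRoot s) = -cs.geomRep w (simpleRoot s) := by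
  rw [geomRep_mul_apply, geomRep_simple_simpleRoot, map_neg]

theorem rootForm_geomRep (w : W) (x y : RootSpace B) :
    rootForm M (cs.geomRep w x) (cs.geomRep w y) = rootForm M x y := by
  induction w using cs.simple_induction_left with
  | one => simp
  | mul_simple_left w i ih =>
    rw [geomRep_mul_apply, geomRep_mul_apply, geomRep_simple, rootForm_simpleReflection, ih]

theorem rootForm_self_of_mem_rootSet {r : RootSpace B} (hr : r ∈ cs.rootSet) :
    rootForm M r r = 1 := by
  obtain ⟨w, s, rfl⟩ := hr
  rw [rootForm_geomRep, rootForm_simpleRoot_self]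

theorem ne_zero_of_mem_rootSet {r : RootSpace B} (hr : r ∈ cs.rootSet) : r ≠ 0 := by
  rintro rfl
  simpa using cs.rootForm_self_of_mem_rootSet hr

theorem geomRep_mem_rootSet (w : W) {r : RootSpace B} (hr : r ∈ cs.rootSet) :
    cs.geomRep w r ∈ cs.rootSet := by
  obtain ⟨v, s, rfl⟩ := hr
  exact ⟨w * v, s, (cs.geomRep_mul_apply _ _ _).symm⟩

theorem geomRep_simpleRoot_mem_rootSet (w : W) (s : B) :
    cs.geomRep w (simpleRoot s) ∈ cs.rootSet := ⟨w, s, rfl⟩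

/-- Commutation of simple reflections is orthogonality of simple roots. -/
theorem commute_simple_iff {s t : B} (h : s ≠ t) :
    Commute (cs.simple s) (cs.simple t) ↔ rootForm M (simpleRoot s) (simpleRoot t) = 0 := by
  constructor
  · intro hc
    have key := congrArg (fun g => cs.geomRep g (simpleRoot t)) hc.eq
    simp only [geomRep_mul_apply, geomRep_simple_simpleRoot, geomRep_simple_apply cs s,
      map_neg, map_sub, map_smul] at key
    rw [geomRep_simple_apply cs t (simpleRoot s)] at key
    -- With `c = (r_s, r_t)`, the `s`-coordinates of `st r_t` and `ts r_t` are `2c` and `-2c`.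
    have := congrFun key s
    simp [simpleRoot, h] at this
    simp only [simpleRoot]
    linarith
  · intro h0
    rw [rootForm_simpleRoot] at h0
    split_ifs at h0 with hM
    · norm_num at h0
    · have h1 := M.off_diagonal s t h
      have h2 : M s t = 2 := by
        by_contra hne
        have h3 : (3 : ℝ) ≤ M s t := by exact_mod_cast (by omega : 3 ≤ M s t)
        have hpi := Real.pi_pos
        have : 0 < Real.cos (Real.pi / (M s t : ℝ)) := by
          apply Real.cos_pos_of_mem_Ioo
          constructor
          · have : 0 < Real.pi / (M s t : ℝ) := by positivity
            linarith
          · rw [div_lt_div_iff₀ (by linarith) (by norm_num)]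
            nlinarith
        linarith
      have hp := cs.simple_mul_simple_pow s t
      rw [h2, pow_two] at hp
      have := eq_inv_of_mul_eq_one_left hp
      simpa [Commute, SemiconjBy] using this

theorem geomRep_simple_of_commute {s t : B} (h : s ≠ t)
    (hc : Commute (cs.simple s) (cs.simple t)) :
    cs.geomRep (cs.simple s) (simpleRoot t) = simpleRoot t := by
  rw [geomRep_simple_apply, (cs.commute_simple_iff h).1 hc]
  simp

/-- Each further reflection replaces one coefficient by the next term of the recurrence; the parity
of `k` tells which of `s`, `t` acts next. -/
theorem geomRep_alternatingWord {s t : B} {U : ℕ → ℝ} (h0 : U 0 = 0) (h1 : U 1 = 1)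
    (hU : ∀ k, U (k + 2) = -(2 * rootForm M (simpleRoot s) (simpleRoot t)) * U (k + 1) - U k)
    (k : ℕ) :
    cs.geomRep (cs.wordProd (alternatingWord s t k)) (simpleRoot s) =
      if Even k then U (k + 1) • simpleRoot s + U k • simpleRoot t
      else U k • simpleRoot s + U (k + 1) • simpleRoot t := by
  induction k with
  | zero => simp [alternatingWord, h0, h1]
  | succ k ih =>
    rw [alternatingWord_succ', wordProd_cons, geomRep_mul_apply, ih, hU]
    have hst := rootForm_comm M (simpleRoot t) (simpleRoot s)
    by_cases hk : Even k
    · have hk' : ¬Even (k + 1) := by simpa [Nat.even_add_one] using hk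
      rw [if_pos hk, if_pos hk, if_neg hk', geomRep_simple_apply, map_add, map_smul, map_smul,
        rootForm_simpleRoot_self, hst]
      simp only [smul_eq_mul]
      module
    · have hk' : Even (k + 1) := by simpa [Nat.even_add_one] using hk
      rw [if_neg hk, if_neg hk, if_pos hk', geomRep_simple_apply, map_add, map_smul, map_smul,
        rootForm_simpleRoot_self]
      simp only [smul_eq_mul]
      module

/-- Induction on length. Pick a descent `t` and factor `w = v d`, with `d` alternating in `s`, `t`
and neither a descent of `v`. Then `d r_s` is a nonnegative combination of `r_s` and `r_t`, and `v`
sends both to nonnegative vectors by induction. -/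
theorem geomRep_simpleRoot_nonneg {w : W} {s : B} (hs : ¬cs.IsRightDescent w s) :
    0 ≤ cs.geomRep w (simpleRoot s) := by
  induction hn : cs.length w using Nat.strong_induction_on generalizing w s with
  | _ n ih =>
  by_cases hw : w = 1
  · subst hw
    simpa using simpleRoot_nonneg s
  obtain ⟨t, ht⟩ := cs.exists_rightDescent_of_ne_one hw
  have hst : s ≠ t := by rintro rfl; exact hs ht
  obtain ⟨k, v, hv, hlen, hvs, hvt⟩ := cs.exists_eq_mul_alternatingWord _ w s t rfl hs
  -- `t` is a descent of `w` but not of `v`, so `v` is strictly shorter and induction applies.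
  have hk : k ≠ 0 := by
    rintro rfl
    apply hvt
    rw [hv] at ht
    simpa [alternatingWord] using ht
  have h1 := ih _ (by omega) hvs rfl
  have h2 := ih _ (by omega) hvt rfl
  obtain ⟨U, hU0, hU1, hU, hpos⟩ := exists_dihedral_coefficients M hst
  have hk1 : M s t = 0 ∨ k + 1 ≤ M s t := by
    -- Since `ℓ(ws) = ℓ(v) + k + 1`, the alternating word of length `k + 1` is reduced, so it cannot
    -- be longer than `m_{st}`.
    by_contra! hcon
    have hcon' : M t s ≠ 0 := by rw [M.symmetric]; exact hcon.1
    apply cs.not_isReduced_alternatingWord t s hcon' (m := k + 1)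
      (by rw [M.symmetric]; exact hcon.2)
    have hle := cs.length_wordProd_le (alternatingWord t s (k + 1))
    have hmul := cs.length_mul_le v (cs.wordProd (alternatingWord t s (k + 1)))
    have heq : v * cs.wordProd (alternatingWord t s (k + 1)) = w * cs.simple s := by
      rw [alternatingWord_succ, wordProd_concat, ← mul_assoc, ← hv]
    rw [heq, cs.not_isRightDescent_iff.1 hs] at hmul
    rw [length_alternatingWord] at hle
    rw [IsReduced, length_alternatingWord]
    omega
  have hUk := hpos k (by omega)
  have hUk1 := hpos (k + 1) hk1
  rw [hv, geomRep_mul_apply, cs.geomRep_alternatingWord hU0 hU1 hU]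
  split_ifs
  all_goals
    rw [map_add, map_smul, map_smul]
    exact add_nonneg (smul_nonneg ‹_› ‹_›) (smul_nonneg ‹_› ‹_›)

theorem geomRep_simpleRoot_nonpos {w : W} {s : B} (hs : cs.IsRightDescent w s) :
    cs.geomRep w (simpleRoot s) ≤ 0 := by
  have := cs.geomRep_simpleRoot_nonneg (cs.isRightDescent_iff_not_isRightDescent_mul.1 hs)
  rwa [geomRep_mul_simple_simpleRoot, neg_nonneg] at this

theorem isRightDescent_iff_geomRep_nonpos {w : W} {s : B} :
    cs.IsRightDescent w s ↔ cs.geomRep w (simpleRoot s) ≤ 0 := by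
  refine ⟨cs.geomRep_simpleRoot_nonpos, fun h => ?_⟩
  by_contra hs
  exact cs.ne_zero_of_mem_rootSet (cs.geomRep_simpleRoot_mem_rootSet w s)
    (le_antisymm h (cs.geomRep_simpleRoot_nonneg hs))

theorem nonneg_or_nonpos_of_mem_rootSet {r : RootSpace B} (hr : r ∈ cs.rootSet) :
    0 ≤ r ∨ r ≤ 0 := by
  obtain ⟨w, s, rfl⟩ := hr
  by_cases hs : cs.IsRightDescent w s
  · exact Or.inr (cs.geomRep_simpleRoot_nonpos hs)
  · exact Or.inl (cs.geomRep_simpleRoot_nonneg hs)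

theorem neg_mem_rootSet {r : RootSpace B} (hr : r ∈ cs.rootSet) : -r ∈ cs.rootSet := by
  obtain ⟨w, s, rfl⟩ := hr
  exact ⟨w * cs.simple s, s, (cs.geomRep_mul_simple_simpleRoot w s).symm⟩

/-- A simple reflection permutes the positive roots other than its own simple root. -/
theorem geomRep_simple_nonneg {r : RootSpace B} (hr : r ∈ cs.rootSet) (h0 : 0 ≤ r) {s : B}
    (hs : r ≠ simpleRoot s) : 0 ≤ cs.geomRep (cs.simple s) r := by
  refine (cs.nonneg_or_nonpos_of_mem_rootSet (cs.geomRep_mem_rootSet _ hr)).resolve_right ?_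
  intro hneg
  apply hs
  -- The reflection changes only the coordinate at `s`, so all other coordinates are both
  -- nonnegative and nonpositive. Norm 1 then forces `r s = 1`.
  have hrs : r = r s • simpleRoot s := by
    ext t
    by_cases hts : t = s
    · subst hts; simp [simpleRoot]
    · have h1 := hneg t
      rw [geomRep_simple_apply] at h1
      have h2 := h0 t
      simp [simpleRoot, hts] at h1 h2 ⊢
      linarith
  have hone := cs.rootForm_self_of_mem_rootSet hr
  rw [hrs] at hone
  simp only [map_smul, LinearMap.smul_apply, smul_eq_mul, rootForm_simpleRoot_self] at hone
  have hs0 : 0 ≤ r s := h0 s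
  have : r s = 1 := by nlinarith
  rw [hrs, this, one_smul]

theorem mem_invSet_iff {w : W} {r : RootSpace B} :
    r ∈ cs.invSet w ↔ r ∈ cs.rootSet ∧ 0 ≤ r ∧ cs.geomRep w⁻¹ r ≤ 0 := by
  constructor
  · rintro ⟨⟨h1, h2⟩, -, h3⟩
    exact ⟨h1, h2, h3⟩
  · rintro ⟨h1, h2, h3⟩
    exact ⟨⟨h1, h2⟩, cs.geomRep_mem_rootSet _ h1, h3⟩

theorem invSet_one : cs.invSet 1 = ∅ := by
  ext r
  simp only [mem_invSet_iff, Set.mem_empty_iff_false, iff_false]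
  rintro ⟨h1, h2, h3⟩
  rw [inv_one, map_one] at h3
  exact cs.ne_zero_of_mem_rootSet h1 (le_antisymm h3 h2)

theorem geomRep_simpleRoot_notMem_invSet (w : W) (s : B) :
    cs.geomRep w (simpleRoot s) ∉ cs.invSet w := by
  rw [mem_invSet_iff, geomRep_inv_apply_self]
  rintro ⟨-, -, h⟩
  have := h s
  simp [simpleRoot] at this
  linarith

/-- Apart from `±r_s`, the reflection `s` preserves the sign of every root, so only the root that
`w⁻¹` carries to `r_s` can change status. -/
theorem invSet_mul_simple {w : W} {s : B} (hs : ¬cs.IsRightDescent w s) :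
    cs.invSet (w * cs.simple s) = insert (cs.geomRep w (simpleRoot s)) (cs.invSet w) := by
  have hpos := cs.geomRep_simpleRoot_nonneg hs
  ext r
  simp only [Set.mem_insert_iff, mem_invSet_iff, mul_inv_rev, inv_simple, geomRep_mul_apply]
  constructor
  · rintro ⟨h1, h2, h3⟩
    by_cases h : cs.geomRep w⁻¹ r = simpleRoot s
    · left
      rw [← h, geomRep_apply_inv_self]
    · refine Or.inr ⟨h1, h2, ?_⟩
      have hroot := cs.geomRep_mem_rootSet w⁻¹ h1
      refine (cs.nonneg_or_nonpos_of_mem_rootSet hroot).resolve_left fun h0 => ?_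
      exact cs.ne_zero_of_mem_rootSet (cs.geomRep_mem_rootSet _ hroot)
        (le_antisymm h3 (cs.geomRep_simple_nonneg hroot h0 h))
  · rintro (rfl | ⟨h1, h2, h3⟩)
    · refine ⟨cs.geomRep_simpleRoot_mem_rootSet w s, hpos, ?_⟩
      rw [geomRep_inv_apply_self, geomRep_simple_simpleRoot, neg_nonpos]
      exact simpleRoot_nonneg s
    · refine ⟨h1, h2, ?_⟩
      have hroot := cs.neg_mem_rootSet (cs.geomRep_mem_rootSet w⁻¹ h1)
      have := cs.geomRep_simple_nonneg (s := s) hroot (neg_nonneg.2 h3) ?_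
      · rwa [map_neg, neg_nonneg] at this
      · intro h
        have hr : r = -cs.geomRep w (simpleRoot s) := by
          rw [← h, map_neg, neg_neg, geomRep_apply_inv_self]
        have : r ≤ 0 := by rw [hr, neg_nonpos]; exact hpos
        exact cs.ne_zero_of_mem_rootSet h1 (le_antisymm this h2)

end Roots

/-! ### Reduced words and commutation equivalence. -/

section Words

variable {B W : Type*} [Group W] {M : CoxeterMatrix B} (cs : CoxeterSystem M W)

theorem wordProd_cons_inv (s : B) (v : List B) :
    (cs.wordProd (s :: v))⁻¹ = (cs.wordProd v)⁻¹ * cs.simple s := by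
  rw [wordProd_cons, mul_inv_rev, inv_simple]

theorem isReduced_cons_iff {s : B} {v : List B} :
    cs.IsReduced (s :: v) ↔ cs.IsReduced v ∧ ¬cs.IsRightDescent (cs.wordProd v)⁻¹ s := by
  rw [isRightDescent_inv_iff, not_isLeftDescent_iff]
  simp only [IsReduced, wordProd_cons, List.length_cons]
  have h1 := cs.length_wordProd_le v
  have h2 := cs.length_simple_mul (cs.wordProd v) s
  omega

theorem CommutationStep.symm {cs : CoxeterSystem M W} {u v : List B}
    (h : cs.CommutationStep u v) : cs.CommutationStep v u := by
  obtain ⟨x, y, a, b, hab, rfl, rfl⟩ := h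
  exact ⟨x, y, b, a, hab.symm, rfl, rfl⟩

theorem CommutationStep.cons {cs : CoxeterSystem M W} {u v : List B}
    (h : cs.CommutationStep u v) (c : B) : cs.CommutationStep (c :: u) (c :: v) := by
  obtain ⟨x, y, a, b, hab, rfl, rfl⟩ := h
  exact ⟨c :: x, y, a, b, hab, rfl, rfl⟩

theorem CommutationStep.reverse {cs : CoxeterSystem M W} {u v : List B}
    (h : cs.CommutationStep u v) : cs.CommutationStep u.reverse v.reverse := by
  obtain ⟨x, y, a, b, hab, rfl, rfl⟩ := h
  exact ⟨y.reverse, x.reverse, b, a, hab.symm, by simp, by simp⟩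

theorem CommutationStep.wordProd_eq {cs : CoxeterSystem M W} {u v : List B}
    (h : cs.CommutationStep u v) : cs.wordProd u = cs.wordProd v := by
  obtain ⟨x, y, a, b, hab, rfl, rfl⟩ := h
  simp only [wordProd_append, wordProd_cons]
  rw [← mul_assoc (cs.simple a), hab.eq, mul_assoc (cs.simple b)]

theorem CommutationStep.isReduced_iff {cs : CoxeterSystem M W} {u v : List B}
    (h : cs.CommutationStep u v) : cs.IsReduced u ↔ cs.IsReduced v := by
  have hl : u.length = v.length := by
    obtain ⟨x, y, a, b, hab, rfl, rfl⟩ := h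
    simp
  rw [IsReduced, IsReduced, h.wordProd_eq, hl]

theorem commutationEquiv_cons {u v : List B} (h : Relation.EqvGen cs.CommutationStep u v)
    (c : B) : Relation.EqvGen cs.CommutationStep (c :: u) (c :: v) := by
  induction h with
  | rel _ _ h => exact .rel _ _ (h.cons c)
  | refl _ => exact .refl _
  | symm _ _ _ ih => exact .symm _ _ ih
  | trans _ _ _ _ _ ih₁ ih₂ => exact .trans _ _ _ ih₁ ih₂

theorem commutationEquiv_reverse {u v : List B} (h : Relation.EqvGen cs.CommutationStep u v) :
    Relation.EqvGen cs.CommutationStep u.reverse v.reverse := by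
  induction h with
  | rel _ _ h => exact .rel _ _ h.reverse
  | refl _ => exact .refl _
  | symm _ _ _ ih => exact .symm _ _ ih
  | trans _ _ _ _ _ ih₁ ih₂ => exact .trans _ _ _ ih₁ ih₂

theorem commutationEquiv_wordProd_isReduced {u v : List B}
    (h : Relation.EqvGen cs.CommutationStep u v) :
    cs.wordProd u = cs.wordProd v ∧ (cs.IsReduced u ↔ cs.IsReduced v) := by
  induction h with
  | rel _ _ h => exact ⟨h.wordProd_eq, h.isReduced_iff⟩
  | refl _ => exact ⟨rfl, Iff.rfl⟩
  | symm _ _ _ ih => exact ⟨ih.1.symm, ih.2.symm⟩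
  | trans _ _ _ _ _ ih₁ ih₂ => exact ⟨ih₁.1.trans ih₂.1, ih₁.2.trans ih₂.2⟩

theorem commutationEquiv_middle (y x : List B) {s : B}
    (h : ∀ c ∈ y, Commute (cs.simple c) (cs.simple s)) :
    Relation.EqvGen cs.CommutationStep (y ++ s :: x) (s :: (y ++ x)) := by
  induction y with
  | nil => exact .refl _
  | cons c y ih =>
    refine .trans _ _ _ (cs.commutationEquiv_cons
      (ih fun d hd => h d (List.mem_cons_of_mem _ hd)) c) ?_
    exact .rel _ _ ⟨[], y ++ x, c, s, h c List.mem_cons_self, rfl, rfl⟩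

end Words

/-! ### Depth functions as functions of words. -/

section Depth

variable {B W : Type*} [Fintype B] [DecidableEq B] [Group W] {M : CoxeterMatrix B}
  (cs : CoxeterSystem M W)

theorem invSet_finite (w : W) : (cs.invSet w).Finite := by
  induction hn : cs.length w using Nat.strong_induction_on generalizing w with
  | _ n ih =>
  by_cases hw : w = 1
  · rw [hw, invSet_one]
    exact Set.finite_empty
  · obtain ⟨t, ht⟩ := cs.exists_rightDescent_of_ne_one hw
    have hfin := ih _ (hn ▸ ht) (w * cs.simple t) rfl
    have := cs.invSet_mul_simple (cs.isRightDescent_iff_not_isRightDescent_mul.1 ht)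
    rw [simple_mul_simple_cancel_right] at this
    rw [this]
    exact hfin.insert _

theorem simpleRoot_injective {B : Type*} [DecidableEq B] :
    Function.Injective (simpleRoot : B → RootSpace B) :=
  fun s t h => by
    by_contra hst
    have := congrFun h s
    simp [simpleRoot, hst] at this

theorem neg_geomRep_mem_invSet {w : W} {s : B} (hs : cs.IsRightDescent w s) :
    -cs.geomRep w (simpleRoot s) ∈ cs.invSet w := by
  have := cs.invSet_mul_simple (cs.isRightDescent_iff_not_isRightDescent_mul.1 hs)
  rw [simple_mul_simple_cancel_right, geomRep_mul_simple_simpleRoot] at this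
  rw [this]
  exact Set.mem_insert _ _

open Classical in
/-- The operation `Φ(·, s)` on functions extended by zero to the whole root space. -/
noncomputable def extendDepthFun (w : W) (s : B) (f : RootSpace B → ℕ) : RootSpace B → ℕ :=
  Function.update f (cs.geomRep w (simpleRoot s))
    (1 + sSup {n : ℕ | ∃ r ∈ cs.invSet w,
      0 < rootForm M (cs.geomRep w (simpleRoot s)) r ∧ n = f r})

theorem extendDepthFun_of_ne {w : W} {s : B} (f : RootSpace B → ℕ) {r : RootSpace B}
    (h : r ≠ cs.geomRep w (simpleRoot s)) : cs.extendDepthFun w s f r = f r := by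
  rw [extendDepthFun, Function.update_of_ne h]

theorem extendDepthFun_of_mem {w : W} {s : B} (f : RootSpace B → ℕ) {r : RootSpace B}
    (h : r ∈ cs.invSet w) : cs.extendDepthFun w s f r = f r :=
  cs.extendDepthFun_of_ne f fun hr => cs.geomRep_simpleRoot_notMem_invSet w s (hr ▸ h)

theorem extendDepthFun_self (w : W) (s : B) (f : RootSpace B → ℕ) :
    cs.extendDepthFun w s f (cs.geomRep w (simpleRoot s)) =
      1 + sSup {n : ℕ | ∃ r ∈ cs.invSet w,
        0 < rootForm M (cs.geomRep w (simpleRoot s)) r ∧ n = f r} := by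
  rw [extendDepthFun, Function.update_self]

/-- Finiteness of `R(w)` bounds the set of values, so the supremum is a genuine upper bound and not
the default 0. -/
theorem lt_extendDepthFun_self {w : W} {s : B} (f : RootSpace B → ℕ) {r : RootSpace B}
    (hr : r ∈ cs.invSet w) (h : 0 < rootForm M (cs.geomRep w (simpleRoot s)) r) :
    f r < cs.extendDepthFun w s f (cs.geomRep w (simpleRoot s)) := by
  rw [extendDepthFun_self, add_comm, Nat.lt_succ_iff]
  refine le_csSup (((cs.invSet_finite w).image f).bddAbove.mono ?_) ⟨r, hr, h, rfl⟩
  rintro n ⟨r', hr', -, rfl⟩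
  exact ⟨r', hr', rfl⟩

theorem coe_extendDepth {w : W} {s : B} (hs : ¬cs.IsRightDescent w s) {lam : cs.invSet w → ℕ+}
    {f : RootSpace B → ℕ} (h : ∀ r, (lam r : ℕ) = f r) (r : cs.invSet (w * cs.simple s)) :
    (cs.extendDepth w s lam r : ℕ) = cs.extendDepthFun w s f r := by
  rw [extendDepth]
  split_ifs with hr
  · rw [extendDepthFun_of_mem _ _ hr, h]
  · have hr' : (r : RootSpace B) = cs.geomRep w (simpleRoot s) := by
      exact ((cs.invSet_mul_simple hs).subset r.2).resolve_right hr
    rw [hr', extendDepthFun_self, Nat.succPNat_coe, Nat.succ_eq_add_one, add_comm]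
    simp only [h, Subtype.exists, exists_prop]

/-- The depth function of the reversal of a word. -/
noncomputable def wordDepth : List B → RootSpace B → ℕ
  | [] => 0
  | s :: v => cs.extendDepthFun (cs.wordProd v)⁻¹ s (wordDepth v)

theorem wordDepth_cons (s : B) (v : List B) :
    cs.wordDepth (s :: v) = cs.extendDepthFun (cs.wordProd v)⁻¹ s (cs.wordDepth v) := rfl

theorem invSet_wordProd_cons_inv {s : B} {v : List B} (h : cs.IsReduced (s :: v)) :
    cs.invSet (cs.wordProd (s :: v))⁻¹ =
      insert (cs.geomRep (cs.wordProd v)⁻¹ (simpleRoot s)) (cs.invSet (cs.wordProd v)⁻¹) := by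
  rw [wordProd_cons_inv, cs.invSet_mul_simple (cs.isReduced_cons_iff.1 h).2]

/-- New values are at least 1, so the support of the depth function recovers the inversion set. -/
theorem wordDepth_eq_zero_iff {v : List B} (h : cs.IsReduced v) {r : RootSpace B} :
    cs.wordDepth v r = 0 ↔ r ∉ cs.invSet (cs.wordProd v)⁻¹ := by
  induction v with
  | nil => simp [wordDepth, invSet_one]
  | cons s v ih =>
    rw [cs.invSet_wordProd_cons_inv h, Set.mem_insert_iff, wordDepth_cons]
    by_cases hr : r = cs.geomRep (cs.wordProd v)⁻¹ (simpleRoot s)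
    · rw [hr, extendDepthFun_self]
      simp
    · rw [extendDepthFun_of_ne _ _ hr, ih (cs.isReduced_cons_iff.1 h).1]
      exact ⟨fun h => not_or.2 ⟨hr, h⟩, fun h => (not_or.1 h).2⟩

theorem exists_wordDepth_of_isDepthFunction {w : W} {lam : cs.invSet w → ℕ+}
    (h : cs.IsDepthFunction w lam) : ∃ v, cs.IsReduced v ∧ (cs.wordProd v)⁻¹ = w ∧
      ∀ r : cs.invSet w, (lam r : ℕ) = cs.wordDepth v r := by
  induction h with
  | one lam =>
    refine ⟨[], by simp [IsReduced], by simp, fun r => ?_⟩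
    exact absurd (cs.invSet_one.subset r.2) (Set.notMem_empty _)
  | step w s hs lam _ ih =>
    obtain ⟨v, hv, rfl, hlam⟩ := ih
    refine ⟨s :: v, cs.isReduced_cons_iff.2 ⟨hv, hs⟩, cs.wordProd_cons_inv s v, ?_⟩
    exact cs.coe_extendDepth hs hlam

theorem isDepthFunction_of_wordDepth {v : List B} (hv : cs.IsReduced v) {w : W}
    (hw : w = (cs.wordProd v)⁻¹) {lam : cs.invSet w → ℕ+}
    (hlam : ∀ r, (lam r : ℕ) = cs.wordDepth v r) : cs.IsDepthFunction w lam := by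
  induction v generalizing w with
  | nil =>
    obtain rfl : w = 1 := by simpa using hw
    exact .one lam
  | cons s v ih =>
    rw [wordProd_cons_inv] at hw
    subst hw
    have hv' := cs.isReduced_cons_iff.1 hv
    let mu : cs.invSet (cs.wordProd v)⁻¹ → ℕ+ := fun r => ⟨cs.wordDepth v r,
      Nat.pos_of_ne_zero fun h0 => (cs.wordDepth_eq_zero_iff hv'.1).1 h0 r.2⟩
    have hmu : cs.IsDepthFunction _ mu := ih hv'.1 rfl fun r => rfl
    have : lam = cs.extendDepth _ s mu := by
      funext r
      apply PNat.coe_injective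
      rw [hlam, cs.coe_extendDepth (f := cs.wordDepth v) hv'.2 fun r => rfl]
      rfl
    rw [this]
    exact .step _ s hv'.2 mu hmu

/-! ### Invariance of depth under commutation. -/

theorem extendDepthFun_mul_simple {w : W} {a b : B} (hb : ¬cs.IsRightDescent w b) (hab : a ≠ b)
    (hc : Commute (cs.simple a) (cs.simple b)) (f : RootSpace B → ℕ) [DecidableEq (RootSpace B)] :
    cs.extendDepthFun (w * cs.simple b) a (cs.extendDepthFun w b f) =
      Function.update (cs.extendDepthFun w b f) (cs.geomRep w (simpleRoot a))
        (cs.extendDepthFun w a f (cs.geomRep w (simpleRoot a))) := by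
  have hroot : cs.geomRep (w * cs.simple b) (simpleRoot a) = cs.geomRep w (simpleRoot a) := by
    rw [geomRep_mul_apply, cs.geomRep_simple_of_commute hab.symm hc.symm]
  rw [extendDepthFun, extendDepthFun_self cs w a, hroot, cs.invSet_mul_simple hb]
  -- The inserted root `w r_b` is orthogonal to `w r_a`, so it fails the strict positivity
  -- condition.
  have hset : {n : ℕ | ∃ r ∈ insert (cs.geomRep w (simpleRoot b)) (cs.invSet w),
        0 < rootForm M (cs.geomRep w (simpleRoot a)) r ∧ n = cs.extendDepthFun w b f r} =
      {n : ℕ | ∃ r ∈ cs.invSet w,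
        0 < rootForm M (cs.geomRep w (simpleRoot a)) r ∧ n = f r} := by
    ext n
    constructor
    · rintro ⟨r, rfl | hr, hpos, rfl⟩
      · rw [rootForm_geomRep, (cs.commute_simple_iff hab).1 hc] at hpos
        exact absurd hpos (lt_irrefl _)
      · exact ⟨r, hr, hpos, cs.extendDepthFun_of_mem f hr⟩
    · rintro ⟨r, hr, hpos, rfl⟩
      exact ⟨r, Or.inr hr, hpos, (cs.extendDepthFun_of_mem f hr).symm⟩
  rw [hset]
  congr!

theorem extendDepthFun_comm {w : W} {a b : B} (ha : ¬cs.IsRightDescent w a)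
    (hb : ¬cs.IsRightDescent w b) (hab : a ≠ b)
    (hc : Commute (cs.simple a) (cs.simple b)) (f : RootSpace B → ℕ) :
    cs.extendDepthFun (w * cs.simple b) a (cs.extendDepthFun w b f) =
      cs.extendDepthFun (w * cs.simple a) b (cs.extendDepthFun w a f) := by
  classical
  rw [cs.extendDepthFun_mul_simple hb hab hc, cs.extendDepthFun_mul_simple ha hab.symm hc.symm]
  have hne : cs.geomRep w (simpleRoot a) ≠ cs.geomRep w (simpleRoot b) :=
    fun h => hab (simpleRoot_injective ((cs.geomRep w).injective h))
  ext r
  by_cases h1 : r = cs.geomRep w (simpleRoot a)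
  · subst h1
    rw [Function.update_self, Function.update_of_ne hne]
  · rw [Function.update_of_ne h1]
    by_cases h2 : r = cs.geomRep w (simpleRoot b)
    · subst h2
      rw [Function.update_self]
    · rw [Function.update_of_ne h2, extendDepthFun_of_ne _ f h1, extendDepthFun_of_ne _ f h2]

theorem wordDepth_eq_of_commutationStep {u v : List B} (h : cs.CommutationStep u v)
    (hu : cs.IsReduced u) : cs.wordDepth u = cs.wordDepth v := by
  have hv := h.isReduced_iff.1 hu
  obtain ⟨x, y, a, b, hab, rfl, rfl⟩ := h
  induction x with
  | nil =>
    by_cases hne : a = b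
    · rw [hne]
    · simp only [List.nil_append] at hu hv ⊢
      have hb := (cs.isReduced_cons_iff.1 (cs.isReduced_cons_iff.1 hu).1).2
      have ha := (cs.isReduced_cons_iff.1 (cs.isReduced_cons_iff.1 hv).1).2
      simp only [wordDepth_cons, wordProd_cons_inv]
      exact cs.extendDepthFun_comm ha hb hne hab _
  | cons c x ih =>
    have hstep : cs.CommutationStep (x ++ a :: b :: y) (x ++ b :: a :: y) :=
      ⟨x, y, a, b, hab, rfl, rfl⟩
    simp only [List.cons_append] at hu hv ⊢
    rw [wordDepth_cons, wordDepth_cons, hstep.wordProd_eq,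
      ih (cs.isReduced_cons_iff.1 hu).1 (cs.isReduced_cons_iff.1 hv).1]

theorem wordDepth_eq_of_commutationEquiv {u v : List B}
    (h : Relation.EqvGen cs.CommutationStep u v) (hu : cs.IsReduced u) :
    cs.wordDepth u = cs.wordDepth v := by
  induction h with
  | rel _ _ h => exact cs.wordDepth_eq_of_commutationStep h hu
  | refl _ => rfl
  | symm _ _ h ih => exact (ih ((cs.commutationEquiv_wordProd_isReduced h).2.2 hu)).symm
  | trans _ _ _ h _ ih₁ ih₂ =>
    exact (ih₁ hu).trans (ih₂ ((cs.commutationEquiv_wordProd_isReduced h).2.1 hu))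

/-! ### Recovering the commutation class from the depth. -/

theorem geomRep_wordProd_inv_simpleRoot {y : List B} {t : B}
    (hy : ∀ c ∈ y, c ≠ t ∧ Commute (cs.simple c) (cs.simple t)) :
    cs.geomRep (cs.wordProd y)⁻¹ (simpleRoot t) = simpleRoot t := by
  induction y with
  | nil => simp
  | cons c y ih =>
    have hc := hy c List.mem_cons_self
    rw [wordProd_cons_inv, geomRep_mul_apply, cs.geomRep_simple_of_commute hc.1 hc.2]
    exact ih fun d hd => hy d (List.mem_cons_of_mem _ hd)

theorem geomRep_wordProd_append_inv {y x : List B} {t : B}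
    (hy : ∀ c ∈ y, c ≠ t ∧ Commute (cs.simple c) (cs.simple t)) :
    cs.geomRep (cs.wordProd (y ++ t :: x))⁻¹ (simpleRoot t) =
      -cs.geomRep (cs.wordProd x)⁻¹ (simpleRoot t) := by
  rw [wordProd_append, mul_inv_rev, geomRep_mul_apply, cs.geomRep_wordProd_inv_simpleRoot hy,
    wordProd_cons_inv, geomRep_mul_simple_simpleRoot]

theorem mem_invSet_iff_exists_append {v : List B} (hv : cs.IsReduced v) {r : RootSpace B} :
    r ∈ cs.invSet (cs.wordProd v)⁻¹ ↔
      ∃ y t x, v = y ++ t :: x ∧ r = cs.geomRep (cs.wordProd x)⁻¹ (simpleRoot t) := by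
  induction v with
  | nil => simp [invSet_one]
  | cons c v ih =>
    rw [cs.invSet_wordProd_cons_inv hv, Set.mem_insert_iff, ih (cs.isReduced_cons_iff.1 hv).1]
    constructor
    · rintro (rfl | ⟨y, t, x, rfl, rfl⟩)
      · exact ⟨[], c, v, rfl, rfl⟩
      · exact ⟨c :: y, t, x, rfl, rfl⟩
    · rintro ⟨_ | ⟨d, y⟩, t, x, h, rfl⟩
      · obtain ⟨rfl, rfl⟩ := List.cons_eq_cons.1 h
        exact Or.inl rfl
      · obtain ⟨rfl, rfl⟩ := List.cons_eq_cons.1 h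
        exact Or.inr ⟨y, t, x, rfl, rfl⟩

/-- A letter of a reduced word either commutes past everything after it, or its root is dominated
by a later root forming an acute angle with it. -/
theorem forall_commute_or_exists_lt {y x : List B} {t : B} (h : cs.IsReduced (y ++ t :: x)) :
    (∀ c ∈ y, c ≠ t ∧ Commute (cs.simple c) (cs.simple t)) ∨
      ∃ r ∈ cs.invSet (cs.wordProd (y ++ t :: x))⁻¹,
        0 < rootForm M (cs.geomRep (cs.wordProd x)⁻¹ (simpleRoot t)) r ∧
        cs.wordDepth (y ++ t :: x) (cs.geomRep (cs.wordProd x)⁻¹ (simpleRoot t)) <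
          cs.wordDepth (y ++ t :: x) r := by
  induction y with
  | nil => left; simp
  | cons c y ih =>
    rw [List.cons_append] at h
    have h' := cs.isReduced_cons_iff.1 h
    have hmem : cs.geomRep (cs.wordProd x)⁻¹ (simpleRoot t) ∈
        cs.invSet (cs.wordProd (y ++ t :: x))⁻¹ :=
      (cs.mem_invSet_iff_exists_append h'.1).2 ⟨y, t, x, rfl, rfl⟩
    rw [List.cons_append, cs.invSet_wordProd_cons_inv h, wordDepth_cons,
      extendDepthFun_of_mem _ _ hmem]
    rcases ih h'.1 with hy | ⟨r, hr, hpos, hlt⟩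
    · have hroot := cs.geomRep_wordProd_append_inv (x := x) hy
      -- If `c = t`, the root added by `c` would be the negative of the positive root already
      -- contributed by `t`.
      have hct : c ≠ t := by
        rintro rfl
        have h1 := cs.geomRep_simpleRoot_nonneg h'.2
        rw [hroot, neg_nonneg] at h1
        exact cs.ne_zero_of_mem_rootSet (cs.geomRep_simpleRoot_mem_rootSet _ _)
          (le_antisymm h1 ((cs.mem_invSet_iff).1 hmem).2.1)
      by_cases hc : Commute (cs.simple c) (cs.simple t)
      · left
        intro d hd
        rcases List.mem_cons.1 hd with rfl | hd
        · exact ⟨hct, hc⟩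
        · exact hy d hd
      · right
        -- Let `g` be the element before `c` is appended. The root of `t` is `-g r_t` and the new
        -- root is `g r_c`; their product is `-(r_c, r_t) > 0`.
        have hpos : 0 < rootForm M (cs.geomRep (cs.wordProd (y ++ t :: x))⁻¹ (simpleRoot c))
            (cs.geomRep (cs.wordProd x)⁻¹ (simpleRoot t)) := by
          rw [← neg_neg (cs.geomRep (cs.wordProd x)⁻¹ (simpleRoot t)), ← hroot, map_neg,
            rootForm_geomRep, neg_pos]
          exact lt_of_le_of_ne (rootForm_simpleRoot_nonpos M hct)
            fun h0 => hc ((cs.commute_simple_iff hct).2 h0)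
        refine ⟨_, Set.mem_insert _ _, ?_, cs.lt_extendDepthFun_self _ hmem hpos⟩
        rwa [rootForm_comm]
    · refine Or.inr ⟨r, Set.mem_insert_of_mem _ hr, hpos, ?_⟩
      rwa [extendDepthFun_of_mem _ _ hr]

/-- A descent whose root has locally maximal depth can be moved to the end of the word. -/
theorem exists_append_of_depth_lt {v : List B} (hv : cs.IsReduced v) {s : B}
    (hs : cs.IsRightDescent (cs.wordProd v)⁻¹ s)
    (hmax : ∀ r ∈ cs.invSet (cs.wordProd v)⁻¹,
      r ≠ -cs.geomRep (cs.wordProd v)⁻¹ (simpleRoot s) →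
      0 < rootForm M (-cs.geomRep (cs.wordProd v)⁻¹ (simpleRoot s)) r →
      cs.wordDepth v r < cs.wordDepth v (-cs.geomRep (cs.wordProd v)⁻¹ (simpleRoot s))) :
    ∃ y x, v = y ++ s :: x ∧ ∀ c ∈ y, c ≠ s ∧ Commute (cs.simple c) (cs.simple s) := by
  obtain ⟨y, t, x, rfl, hr⟩ :=
    (cs.mem_invSet_iff_exists_append hv).1 (cs.neg_geomRep_mem_invSet hs)
  rcases cs.forall_commute_or_exists_lt hv with hy | ⟨r, hrm, hpos, hlt⟩
  · rw [neg_eq_iff_eq_neg, ← cs.geomRep_wordProd_append_inv hy] at hr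
    obtain rfl : s = t := simpleRoot_injective ((cs.geomRep _).injective hr)
    exact ⟨y, x, rfl, hy⟩
  · rw [← hr] at hpos hlt
    have hne : r ≠ -cs.geomRep (cs.wordProd (y ++ t :: x))⁻¹ (simpleRoot s) := by
      rintro rfl
      exact lt_irrefl _ hlt
    exact absurd (hmax r hrm hne hpos) hlt.asymm

/-- If a reduced word has the depth function of a word ending in `s`, then `s` can be moved to its
end. -/
theorem exists_append_of_wordDepth_eq {u v : List B} {s : B} (hu : cs.IsReduced (s :: u))
    (hv : cs.IsReduced v) (hp : cs.wordProd v = cs.wordProd (s :: u))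
    (hd : cs.wordDepth v = cs.wordDepth (s :: u)) :
    ∃ y x, v = y ++ s :: x ∧ ∀ c ∈ y, c ≠ s ∧ Commute (cs.simple c) (cs.simple s) := by
  have hroot : -cs.geomRep (cs.wordProd v)⁻¹ (simpleRoot s) =
      cs.geomRep (cs.wordProd u)⁻¹ (simpleRoot s) := by
    rw [hp, wordProd_cons_inv, geomRep_mul_simple_simpleRoot, neg_neg]
  apply cs.exists_append_of_depth_lt hv
  · rw [hp, isRightDescent_iff_not_isRightDescent_mul, wordProd_cons_inv,
      simple_mul_simple_cancel_right]
    exact (cs.isReduced_cons_iff.1 hu).2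
  · rw [hroot, hd, hp, cs.invSet_wordProd_cons_inv hu, wordDepth_cons]
    rintro r (rfl | hr) hne hpos
    · exact absurd rfl hne
    · rw [extendDepthFun_of_mem _ _ hr]
      exact cs.lt_extendDepthFun_self _ hr hpos

/-- Only the value at the new root is overwritten, so fixing it to be 0 beforehand makes the step
reversible. Depth functions of `w` vanish there. -/
theorem extendDepthFun_injOn (w : W) (s : B) :
    Set.InjOn (cs.extendDepthFun w s) {f | f (cs.geomRep w (simpleRoot s)) = 0} := by
  intro f hf g hg h
  ext r
  by_cases hr : r = cs.geomRep w (simpleRoot s)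
  · rw [hr, hf, hg]
  · rw [← cs.extendDepthFun_of_ne f hr, h, cs.extendDepthFun_of_ne g hr]

theorem wordDepth_apply_geomRep {v : List B} (hv : cs.IsReduced v) (s : B) :
    cs.wordDepth v (cs.geomRep (cs.wordProd v)⁻¹ (simpleRoot s)) = 0 :=
  (cs.wordDepth_eq_zero_iff hv).2 (cs.geomRep_simpleRoot_notMem_invSet _ s)

theorem wordDepth_cons_inj {u v : List B} {s : B} (hu : cs.IsReduced u) (hv : cs.IsReduced v)
    (hp : cs.wordProd u = cs.wordProd v) :
    cs.wordDepth (s :: u) = cs.wordDepth (s :: v) ↔ cs.wordDepth u = cs.wordDepth v := by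
  rw [wordDepth_cons, wordDepth_cons, hp]
  exact (cs.extendDepthFun_injOn _ s).eq_iff (hp ▸ cs.wordDepth_apply_geomRep hu s)
    (cs.wordDepth_apply_geomRep hv s)

/-- Depth functions separate commutation classes. -/
theorem commutationEquiv_of_wordDepth_eq {u v : List B} (hu : cs.IsReduced u)
    (hv : cs.IsReduced v) (hp : cs.wordProd u = cs.wordProd v)
    (hd : cs.wordDepth u = cs.wordDepth v) : Relation.EqvGen cs.CommutationStep u v := by
  induction u generalizing v with
  | nil =>
    have : v = [] := by
      rw [← List.length_eq_zero_iff, ← hv, ← hp]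
      simp
    rw [this]
    exact .refl _
  | cons s u ih =>
    obtain ⟨y, x, rfl, hy⟩ := cs.exists_append_of_wordDepth_eq hu hv hp.symm hd.symm
    have hmid := cs.commutationEquiv_middle y x fun c hc => (hy c hc).2
    have hmid' := cs.commutationEquiv_wordProd_isReduced hmid
    have hu' := (cs.isReduced_cons_iff.1 hu).1
    have hv' := (cs.isReduced_cons_iff.1 (hmid'.2.1 hv)).1
    rw [hmid'.1, wordProd_cons, wordProd_cons, mul_right_inj] at hp
    rw [cs.wordDepth_eq_of_commutationEquiv hmid hv, cs.wordDepth_cons_inj hu' hv' hp] at hd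
    exact .trans _ _ _ (cs.commutationEquiv_cons (ih hu' hv' hp hd) s) (.symm _ _ hmid)

end Depth

/-! ### Cardinalities and bijection with commutation classes. -/

section Counting

variable {B W : Type*} [Fintype B] [DecidableEq B] [Group W] {M : CoxeterMatrix B}
  (cs : CoxeterSystem M W)

/-- The depth functions of reduced words of `w`, extended by zero to the whole root space. -/
def depthSet (w : W) : Set (RootSpace B → ℕ) :=
  {f | ∃ v, cs.IsReduced v ∧ (cs.wordProd v)⁻¹ = w ∧ cs.wordDepth v = f}

/-- The depth functions of reduced words of `w` that end in `s`. -/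
def depthSetEnding (w : W) (s : B) : Set (RootSpace B → ℕ) :=
  {f | ∃ v, cs.IsReduced (s :: v) ∧ (cs.wordProd (s :: v))⁻¹ = w ∧ cs.wordDepth (s :: v) = f}

/-- The depth functions of `w` whose commutation class has, for each letter of `T`, a word ending
in that letter. -/
def depthSetEndings (T : Finset B) (w : W) : Set (RootSpace B → ℕ) :=
  {f | f ∈ cs.depthSet w ∧ ∀ t ∈ T, f ∈ cs.depthSetEnding w t}

theorem depthSet_finite (w : W) : (cs.depthSet w).Finite := by
  refine ((List.finite_length_eq B (cs.length w)).image cs.wordDepth).subset ?_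
  rintro _ ⟨v, hv, rfl, rfl⟩
  exact ⟨v, by rw [Set.mem_ofPred_eq, length_inv, hv.eq], rfl⟩

theorem depthSetEnding_subset (w : W) (s : B) : cs.depthSetEnding w s ⊆ cs.depthSet w :=
  fun _ ⟨v, h⟩ => ⟨s :: v, h⟩

theorem depthSetEnding_finite (w : W) (s : B) : (cs.depthSetEnding w s).Finite :=
  (cs.depthSet_finite w).subset (cs.depthSetEnding_subset w s)

open Classical in
/-- Extension by zero of a function on `R(w)`. -/
noncomputable def zeroExtension (w : W) (lam : cs.invSet w → ℕ+) : RootSpace B → ℕ :=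
  fun r => if h : r ∈ cs.invSet w then lam ⟨r, h⟩ else 0

theorem zeroExtension_coe (w : W) (lam : cs.invSet w → ℕ+) (r : cs.invSet w) :
    cs.zeroExtension w lam r = lam r := by
  simp [zeroExtension]

theorem zeroExtension_injective (w : W) : Function.Injective (cs.zeroExtension w) := by
  intro lam mu h
  funext r
  apply PNat.coe_injective
  rw [← zeroExtension_coe, h, zeroExtension_coe]

theorem image_zeroExtension (w : W) :
    cs.zeroExtension w '' cs.depthFunctions w = cs.depthSet w := by
  ext f
  constructor
  · rintro ⟨lam, hlam, rfl⟩
    obtain ⟨v, hv, rfl, h⟩ := cs.exists_wordDepth_of_isDepthFunction hlam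
    refine ⟨v, hv, rfl, ?_⟩
    funext r
    by_cases hr : r ∈ cs.invSet (cs.wordProd v)⁻¹
    · exact (h ⟨r, hr⟩).symm.trans (cs.zeroExtension_coe _ lam ⟨r, hr⟩).symm
    · rw [(cs.wordDepth_eq_zero_iff hv).2 hr, zeroExtension, dif_neg hr]
  · rintro ⟨v, hv, rfl, rfl⟩
    refine ⟨fun r => ⟨cs.wordDepth v r,
      Nat.pos_of_ne_zero fun h0 => (cs.wordDepth_eq_zero_iff hv).1 h0 r.2⟩,
      cs.isDepthFunction_of_wordDepth hv rfl fun r => rfl, ?_⟩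
    funext r
    by_cases hr : r ∈ cs.invSet (cs.wordProd v)⁻¹
    · exact dif_pos hr
    · rw [(cs.wordDepth_eq_zero_iff hv).2 hr]
      exact dif_neg hr

theorem depthFunctions_finite (w : W) : (cs.depthFunctions w).Finite := by
  rw [← Set.finite_image_iff (cs.zeroExtension_injective w).injOn, image_zeroExtension]
  exact cs.depthSet_finite w

theorem ncard_depthFunctions (w : W) :
    (cs.depthFunctions w).ncard = (cs.depthSet w).ncard := by
  rw [← image_zeroExtension, Set.ncard_image_of_injective _ (cs.zeroExtension_injective w)]

/-- The depth function of a commutation class. -/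
noncomputable def classDepth (w : W) : cs.CommutationClass w → cs.depthSet w :=
  Quotient.lift
    (fun u => ⟨cs.wordDepth u.1.reverse, u.1.reverse, (cs.isReduced_reverse_iff _).2 u.2.1, by
      rw [wordProd_reverse, inv_inv, u.2.2], rfl⟩)
    fun u _ h => Subtype.ext (cs.wordDepth_eq_of_commutationEquiv (cs.commutationEquiv_reverse h)
      ((cs.isReduced_reverse_iff _).2 u.2.1))

theorem classDepth_bijective (w : W) : Function.Bijective (cs.classDepth w) := by
  constructor
  · rintro ⟨u⟩ ⟨v⟩ h
    refine Quotient.sound ?_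
    have := cs.commutationEquiv_reverse (cs.commutationEquiv_of_wordDepth_eq
      ((cs.isReduced_reverse_iff _).2 u.2.1) ((cs.isReduced_reverse_iff _).2 v.2.1)
      (by rw [wordProd_reverse, wordProd_reverse, u.2.2, v.2.2]) (congrArg Subtype.val h))
    rwa [List.reverse_reverse, List.reverse_reverse] at this
  · rintro ⟨_, v, hv, rfl, rfl⟩
    refine ⟨Quotient.mk _ ⟨v.reverse, (cs.isReduced_reverse_iff _).2 hv,
      cs.wordProd_reverse v⟩, ?_⟩
    exact Subtype.ext (congrArg cs.wordDepth v.reverse_reverse)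

theorem finite_commutationClass (w : W) : Finite (cs.CommutationClass w) :=
  have := (cs.depthSet_finite w).to_subtype
  Finite.of_injective _ (cs.classDepth_bijective w).1

theorem card_commutationClass (w : W) :
    Nat.card (cs.CommutationClass w) = (cs.depthSet w).ncard :=
  Nat.card_eq_of_bijective _ (cs.classDepth_bijective w)

/-! ### Inclusion-exclusion over final letters. -/

theorem isRightDescent_mul_simple_of_commute {w : W} {a t : B} (hat : a ≠ t)
    (hc : Commute (cs.simple a) (cs.simple t)) (ht : cs.IsRightDescent w t) :
    cs.IsRightDescent (w * cs.simple a) t := by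
  rw [isRightDescent_iff_geomRep_nonpos] at ht ⊢
  rwa [geomRep_mul_apply, cs.geomRep_simple_of_commute hat hc]

/-- In a word ending in `a`, some `t` can be moved to the end. As `t ≠ a`, it passes `a`, so they
commute, and stopping just before `a` brings `t` to the end of the shorter word. -/
theorem commute_and_mem_depthSetEnding {a t : B} {u : List B} (hat : a ≠ t)
    (hu : cs.IsReduced (a :: u))
    (h : cs.wordDepth (a :: u) ∈ cs.depthSetEnding (cs.wordProd (a :: u))⁻¹ t) :
    Commute (cs.simple a) (cs.simple t) ∧
      cs.wordDepth u ∈ cs.depthSetEnding (cs.wordProd u)⁻¹ t := by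
  obtain ⟨v, hv, hp, hd⟩ := h
  obtain ⟨_ | ⟨c, y⟩, x, heq, hy⟩ :=
    cs.exists_append_of_wordDepth_eq hv hu (inv_injective hp).symm hd.symm
  · exact absurd (List.cons_eq_cons.1 heq).1 hat
  · obtain ⟨rfl, rfl⟩ := List.cons_eq_cons.1 heq
    refine ⟨(hy a List.mem_cons_self).2, y ++ x, ?_⟩
    have hmid := cs.commutationEquiv_middle y x
      fun c hc => (hy c (List.mem_cons_of_mem _ hc)).2
    have hu' := (cs.isReduced_cons_iff.1 hu).1
    have hmid' := cs.commutationEquiv_wordProd_isReduced hmid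
    exact ⟨hmid'.2.1 hu', congrArg (·⁻¹) hmid'.1.symm, (cs.wordDepth_eq_of_commutationEquiv hmid hu').symm⟩

theorem depthSetEndings_insert {T : Finset B} {w : W} {a : B} (ha : a ∉ T)
    (hw : cs.IsRightDescent w a) (hc : ∀ t ∈ T, Commute (cs.simple a) (cs.simple t)) :
    cs.depthSetEndings (insert a T) w =
      cs.extendDepthFun (w * cs.simple a) a '' cs.depthSetEndings T (w * cs.simple a) := by
  ext f
  constructor
  · rintro ⟨-, hf⟩
    obtain ⟨u, hu, rfl, rfl⟩ := hf a (Finset.mem_insert_self a T)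
    refine ⟨cs.wordDepth u, ?_, ?_⟩ <;>
      simp only [wordProd_cons_inv, simple_mul_simple_cancel_right]
    · refine ⟨⟨u, (cs.isReduced_cons_iff.1 hu).1, rfl, rfl⟩, fun t ht => ?_⟩
      exact (cs.commute_and_mem_depthSetEnding (by rintro rfl; exact ha ht) hu
        (hf t (Finset.mem_insert_of_mem ht))).2
    · rfl
  · have hcons : ∀ v, cs.IsReduced v → (cs.wordProd v)⁻¹ = w * cs.simple a →
        cs.IsReduced (a :: v) ∧ (cs.wordProd (a :: v))⁻¹ = w ∧
          cs.wordDepth (a :: v) =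
            cs.extendDepthFun (w * cs.simple a) a (cs.wordDepth v) := by
      intro v hv hp
      refine ⟨cs.isReduced_cons_iff.2 ⟨hv, ?_⟩, ?_, ?_⟩
      · rw [hp]
        exact cs.isRightDescent_iff_not_isRightDescent_mul.1 hw
      · rw [wordProd_cons_inv, hp, simple_mul_simple_cancel_right]
      · rw [wordDepth_cons, hp]
    rintro ⟨_, ⟨⟨v, hv, hp, rfl⟩, hg⟩, rfl⟩
    refine ⟨⟨a :: v, hcons v hv hp⟩, fun t ht => ?_⟩
    rcases Finset.mem_insert.1 ht with rfl | ht
    · exact ⟨v, hcons v hv hp⟩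
    -- Append `a` to a word ending in `t`, then interchange these two last letters.
    · obtain ⟨x, hx, hxp, hxd⟩ := hg t ht
      obtain ⟨h1, h2, h3⟩ := hcons (t :: x) hx hxp
      have hstep : cs.CommutationStep (a :: t :: x) (t :: a :: x) :=
        ⟨[], x, a, t, hc t ht, rfl, rfl⟩
      refine ⟨a :: x, hstep.isReduced_iff.1 h1, ?_, ?_⟩
      · rw [← hstep.wordProd_eq, h2]
      · rw [← cs.wordDepth_eq_of_commutationStep hstep h1, h3, hxd]

/-- Strip the letters of `T` one at a time; each removal is inverse to an injective extension step,
and the remaining letters stay descents because they commute with the removed one. -/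
theorem ncard_depthSetEndings (T : Finset B) : ∀ (w : W),
    (∀ s ∈ T, cs.IsRightDescent w s) → ∀ hT : cs.IsIndependent T,
    (cs.depthSetEndings T w).ncard = (cs.depthSet (w * cs.independentProd T hT)).ncard := by
  induction T using Finset.induction_on with
  | empty =>
    intro w _ _
    have hone : cs.independentProd ∅ ‹_› = 1 := Finset.noncommProd_empty _ _
    simp [depthSetEndings, hone]
  | insert a T ha ih =>
    intro w hw hT
    have hT' : cs.IsIndependent T := hT.mono (by simp)
    have hc : ∀ t ∈ T, Commute (cs.simple a) (cs.simple t) := fun t ht =>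
      hT (by simp) (by simp [ht]) fun h => ha (h ▸ ht)
    have hprod : cs.independentProd (insert a T) hT = cs.simple a * cs.independentProd T hT' :=
      Finset.noncommProd_insert_of_notMem _ _ _ _ ha
    have hwa := hw a (Finset.mem_insert_self a T)
    rw [hprod, ← mul_assoc, cs.depthSetEndings_insert ha hwa hc, Set.InjOn.ncard_image,
      ih (w * cs.simple a)]
    · exact fun t ht => cs.isRightDescent_mul_simple_of_commute (fun h => ha (h ▸ ht)) (hc t ht)
        (hw t (Finset.mem_insert_of_mem ht))
    · refine (cs.extendDepthFun_injOn _ a).mono ?_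
      rintro _ ⟨⟨v, hv, hp, rfl⟩, -⟩
      exact hp ▸ cs.wordDepth_apply_geomRep hv a

theorem isIndependent_of_mem_depthSetEndings {T : Finset B} {w : W} {f : RootSpace B → ℕ}
    (hf : f ∈ cs.depthSetEndings T w) : cs.IsIndependent T := by
  intro s hs t ht hst
  obtain ⟨u, hu, rfl, rfl⟩ := hf.2 s hs
  exact (cs.commute_and_mem_depthSetEnding hst hu (hf.2 t ht)).1

theorem isRightDescent_of_mem_depthSetEnding {w : W} {s : B} {f : RootSpace B → ℕ}
    (hf : f ∈ cs.depthSetEnding w s) : cs.IsRightDescent w s := by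
  obtain ⟨v, hv, rfl, -⟩ := hf
  rw [isRightDescent_iff_not_isRightDescent_mul, wordProd_cons_inv,
    simple_mul_simple_cancel_right]
  exact (cs.isReduced_cons_iff.1 hv).2

theorem exists_mem_depthSetEnding {w : W} (hw : w ≠ 1) {f : RootSpace B → ℕ}
    (hf : f ∈ cs.depthSet w) : ∃ s, f ∈ cs.depthSetEnding w s := by
  obtain ⟨_ | ⟨s, v⟩, hv, hp, hd⟩ := hf
  · exact absurd hp.symm (by simpa using hw)
  · exact ⟨s, v, hv, hp, hd⟩

theorem ncard_depthSet_eq_sum {w : W} (hw : w ≠ 1) :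
    ((cs.depthSet w).ncard : ℤ) = ∑ T : cs.IndependentDescents w,
      (-1 : ℤ) ^ (T.1.card + 1) *
        ((cs.depthSet (w * cs.independentProd T.1 T.2.2.2)).ncard : ℤ) := by
  classical
  let F : B → Finset (RootSpace B → ℕ) := fun s => (cs.depthSetEnding_finite w s).toFinset
  let D : Finset B := Finset.univ.filter (cs.IsRightDescent w)
  let g : Finset B → ℤ := fun T => (-1) ^ (T.card + 1) * ((cs.depthSetEndings T w).ncard : ℤ)
  have hU : ((D.biUnion F : Finset _) : Set (RootSpace B → ℕ)) = cs.depthSet w := by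
    ext f
    simp only [Finset.coe_biUnion, Set.mem_iUnion, Finset.mem_coe, exists_prop, F,
      Set.Finite.mem_toFinset]
    constructor
    · rintro ⟨s, -, hf⟩
      exact cs.depthSetEnding_subset w s hf
    · intro hf
      obtain ⟨s, hs⟩ := cs.exists_mem_depthSetEnding hw hf
      exact ⟨s, by simpa [D] using cs.isRightDescent_of_mem_depthSetEnding hs, hs⟩
  have hinf : ∀ (T : Finset B) (hT : T.Nonempty),
      (T.inf' hT F).card = (cs.depthSetEndings T w).ncard := by
    intro T hT
    rw [← Set.ncard_coe_finset]
    congr 1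
    ext f
    simp only [Finset.mem_coe, Finset.mem_inf', F, Set.Finite.mem_toFinset]
    obtain ⟨t, ht⟩ := hT
    exact ⟨fun h => ⟨cs.depthSetEnding_subset w t (h t ht), h⟩, fun h => h.2⟩
  rw [← hU, Set.ncard_coe_finset, Finset.inclusion_exclusion_card_biUnion]
  calc _ = ∑ T : D.powerset.filter (·.Nonempty), g T.1 :=
        Finset.sum_congr rfl fun T _ => by rw [hinf]
    _ = ∑ T ∈ D.powerset.filter (·.Nonempty), g T := Finset.sum_coe_sort _ g
    _ = ∑ T ∈ Finset.univ.filter (fun T : Finset B => T.Nonempty ∧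
          (∀ s ∈ T, cs.IsRightDescent w s) ∧ cs.IsIndependent T), g T := by
        symm
        apply Finset.sum_subset
        · intro T hT
          obtain ⟨h1, h2, -⟩ := (Finset.mem_filter.1 hT).2
          exact Finset.mem_filter.2
            ⟨Finset.mem_powerset.2 fun s hs => by simpa [D] using h2 s hs, h1⟩
        · intro T hT hT'
          obtain ⟨h1, h2⟩ := Finset.mem_filter.1 hT
          -- A depth function attaining every final letter in `T` would make `T` an independent set
          -- of descents, so all other terms vanish.
          have hemp : cs.depthSetEndings T w = ∅ := by
            rw [Set.eq_empty_iff_forall_notMem]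
            intro f hf
            exact hT' (Finset.mem_filter.2 ⟨Finset.mem_univ _, h2,
              fun s hs => cs.isRightDescent_of_mem_depthSetEnding (hf.2 s hs),
              cs.isIndependent_of_mem_depthSetEndings hf⟩)
          simp [g, hemp]
    _ = ∑ T : cs.IndependentDescents w, g T.1 :=
        Finset.sum_subtype _ (fun T => by simp) g
    _ = _ := Finset.sum_congr rfl fun T _ => by
        rw [← cs.ncard_depthSetEndings T.1 w T.2.2.1 T.2.2.2]

end Counting

end CoxeterSystem

theorem theorem2p3 {B W : Type*} [Fintype B] [DecidableEq B] [Group W] {M : CoxeterMatrix B}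
    (cs : CoxeterSystem M W) (w : W) :
    (cs.depthFunctions w).Finite ∧
    Finite (cs.CommutationClass w) ∧
    (cs.depthFunctions w).ncard = Nat.card (cs.CommutationClass w) ∧
    (w ≠ 1 →
      ((cs.depthFunctions w).ncard : ℤ) =
        ∑ T : cs.IndependentDescents w,
          (-1 : ℤ) ^ (T.1.card + 1) *
            ((cs.depthFunctions (w * cs.independentProd T.1 T.2.2.2)).ncard : ℤ)) := by
  refine ⟨cs.depthFunctions_finite w, cs.finite_commutationClass w, ?_, fun hw => ?_⟩
  · rw [cs.ncard_depthFunctions, cs.card_commutationClass]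
  · simp only [cs.ncard_depthFunctions]
    exact cs.ncard_depthSet_eq_sum hw
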